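/- Setting. For $C\subset\mathbb{R}^n$ let $\Omega_C=\mathbb{S}^{n-1}\cap\operatorname{int}C$ and $C^\circ=\{x:\langle x,y\rangle\le 0\ \forall y\in C\}$. A pseudo-cone is a nonempty closed convex set $K\subset\mathbb{R}^n$ with $o\notin K$ and $\lambda x\in K$ for all $x\in K$, $\lambda>1$; it is a $C$-pseudo-cone, written $K\in ps(C)$, if $C=\{z:K+z\subset K\}$ and $C$ is $n$-dimensional and pointed (contains no line). A $C$-full set is a closed convex set $L\subset C$ with $C\setminus L$ bounded. For $K\in ps(C)$ let $h_K(v)=\sup_{x\in K}\langle v,x\rangle$ for $v\in\operatorname{cl}\Omega_{C^\circ}$, and $\rho_K(u)=\min\{r>0:ru\in K\}$ for $u\in\Omega_{C,K}:=\{u\in\operatorname{cl}\Omega_C:\ ru\in K\text{ for some }r>0\}$. For $\eta\subset\Omega_C$ let $\boldsymbol{\alpha}_K(\eta)$ be the set of all $v\in\operatorname{cl}\Omega_{C^\circ}$ with $\langle\rho_K(u)u,v\rangle=h_K(v)$ for some $u\in\eta$. Let $\omega_K$ be the set of all $v\in\operatorname{cl}\Omega_{C^\circ}$ for which $\langle x,v\rangle=h_K(v)$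 holds at more than one point $x\in\partial K$. For $v\in\Omega_{C^\circ}\setminus\omega_K$ let $\alpha_K^*(v)\in\Omega_{C,K}$ be the direction $u$ such that $\rho_K(u)u$ is the unique $x\in\partial K$ with $\langle x,v\rangle=h_K(v)$. For a continuous $\phi:(0,\infty)\to(0,\infty)$ and a Borel set $\eta\subset\Omega_C$, put $$J_\phi(K,\eta)=\int_{\boldsymbol{\alpha}_K(\eta)}\phi\big(\rho_K(\alpha_K^*(v))\big)\,dv\in[0,\infty],$$ where $dv$ is spherical Lebesgue measure on $\mathbb{S}^{n-1}$ and the integral extends over the part of $\boldsymbol{\alpha}_K(\eta)$ on which $\alpha^*_K$ is defined, i.e. that lies in $\Omega_{C^\circ}\setminus\omega_K$. For a nonempty compact set $\eta\subset\Omega_C$, $K\in ps(C)$ is called $C$-defined by $\eta$ if $K=\bigcap\{L\in ps(C):\rho_K(u)u\in L\text{ for all }u\in\eta\}$. Lemma. Let $C_1\subset C_2$ be $n$-dimensional pointed closed convex cones in $\mathbb{R}^n$ such that $\mathbb{S}^{n-1}\cap C_1$ is a nonempty (compact) subset of $\Omega_{C_2}$, and let $K$ be a $C_2$-pseudo-cone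 that is $C_2$-defined by $\mathbb{S}^{n-1}\cap C_1$. Then $K\cap C_1$ is a $C_1$-pseudo-cone, and it is a $C_1$-full set. Moreover, for every continuous $\phi:(0,\infty)\to(0,\infty)$, $$J_\phi(K,\eta)=J_\phi(K\cap C_1,\eta)\quad\text{for every Borel set }\eta\subset\Omega_{C_1},$$ where the left side is taken for $K\in ps(C_2)$ and the right side for $K\cap C_1\in ps(C_1)$. -/

import Mathlib

open MeasureTheory Metric Set
open scoped ENNReal

noncomputable section

namespace PseudoCones

variable {n : ℕ}

/-- An `n`-dimensional pointed closed convex cone in `ℝⁿ`. For a convex set, being `n`-dimensional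
means having interior points; "pointed" means containing no line. -/
structure IsSolidPointedCone (C : Set (EuclideanSpace ℝ (Fin n))) : Prop where
  isClosed : IsClosed C
  convex : Convex ℝ C
  zero_mem : (0 : EuclideanSpace ℝ (Fin n)) ∈ C
  smul_mem : ∀ c : ℝ, 0 ≤ c → ∀ x ∈ C, c • x ∈ C
  pointed : ∀ x ∈ C, -x ∈ C → x = 0
  solid : (interior C).Nonempty

/-- A pseudo-cone: a nonempty closed convex set `K` with `o ∉ K` and `λ x ∈ K` for all `λ > 1`,
`x ∈ K`. -/
structure IsPseudoCone (K : Set (EuclideanSpace ℝ (Fin n))) : Prop where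
  nonempty : K.Nonempty
  isClosed : IsClosed K
  convex : Convex ℝ K
  zero_notMem : (0 : EuclideanSpace ℝ (Fin n)) ∉ K
  smul_mem : ∀ c : ℝ, 1 < c → ∀ x ∈ K, c • x ∈ K

/-- The recession cone `rec K = {z : K + z ⊆ K}`. -/
def recessionCone (K : Set (EuclideanSpace ℝ (Fin n))) : Set (EuclideanSpace ℝ (Fin n)) :=
  {z | ∀ x ∈ K, x + z ∈ K}

/-- `K ∈ ps(C)`: `K` is a pseudo-cone whose recession cone is `C`, where `C` is `n`-dimensional and
pointed. -/
structure IsConePseudoCone (C K : Set (EuclideanSpace ℝ (Fin n))) : Prop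
    extends IsPseudoCone K where
  recessionCone_eq : recessionCone K = C
  solid : (interior C).Nonempty
  pointed : ∀ x ∈ C, -x ∈ C → x = 0

/-- A `C`-full set: a closed convex subset `K` of `C` such that `C \ K` is bounded. -/
structure IsFull (C K : Set (EuclideanSpace ℝ (Fin n))) : Prop where
  isClosed : IsClosed K
  convex : Convex ℝ K
  subset : K ⊆ C
  isBounded_diff : Bornology.IsBounded (C \ K)

/-- The dual cone `C° = {x : ⟨x, y⟩ ≤ 0 for all y ∈ C}`. -/
def dualCone (C : Set (EuclideanSpace ℝ (Fin n))) : Set (EuclideanSpace ℝ (Fin n)) :=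
  {x | ∀ y ∈ C, inner ℝ x y ≤ 0}

/-- `Ω_C = S^{n-1} ∩ int C`. -/
def Omega (C : Set (EuclideanSpace ℝ (Fin n))) : Set (EuclideanSpace ℝ (Fin n)) :=
  sphere 0 1 ∩ interior C

/-- The support function `h_K(v) = sup_{x ∈ K} ⟨v, x⟩`, used for `v ∈ cl Ω_{C°}`, where the
supremum is finite for `K ∈ ps(C)`. -/
def supportFun (K : Set (EuclideanSpace ℝ (Fin n))) (v : EuclideanSpace ℝ (Fin n)) : ℝ :=
  sSup ((fun x => inner ℝ v x) '' K)

/-- `Ω_{C,K} = {u ∈ cl Ω_C : r u ∈ K for some r > 0}`. -/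
def OmegaOf (C K : Set (EuclideanSpace ℝ (Fin n))) : Set (EuclideanSpace ℝ (Fin n)) :=
  {u | u ∈ closure (Omega C) ∧ ∃ r : ℝ, 0 < r ∧ r • u ∈ K}

/-- The radial function `ρ_K(u) = min {r > 0 : r u ∈ K}`, used for `u ∈ Ω_{C,K}`; there the infimum
is attained, because `K` is closed and does not contain the origin. -/
def radialFun (K : Set (EuclideanSpace ℝ (Fin n))) (u : EuclideanSpace ℝ (Fin n)) : ℝ :=
  sInf {r : ℝ | 0 < r ∧ r • u ∈ K}

/-- The radial map `r_K(u) = ρ_K(u) u`. -/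
def radialMap (K : Set (EuclideanSpace ℝ (Fin n))) (u : EuclideanSpace ℝ (Fin n)) :
    EuclideanSpace ℝ (Fin n) :=
  radialFun K u • u

/-- The Gauss image of `σ ⊆ ∂K`: all `v ∈ cl Ω_{C°}` with `⟨y, v⟩ = h_K(v)` for some `y ∈ σ`. -/
def gaussImage (C K σ : Set (EuclideanSpace ℝ (Fin n))) : Set (EuclideanSpace ℝ (Fin n)) :=
  {v | v ∈ closure (Omega (dualCone C)) ∧ ∃ y ∈ σ, inner ℝ y v = supportFun K v}

/-- The radial Gauss image of `η ⊆ Ω_{C,K}`. -/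
def radialGaussImage (C K η : Set (EuclideanSpace ℝ (Fin n))) : Set (EuclideanSpace ℝ (Fin n)) :=
  gaussImage C K (radialMap K '' η)

/-- The set `ω_K` of all `v ∈ cl Ω_{C°}` that are outer unit normals of `K` at more than one
boundary point. -/
def irregularNormals (C K : Set (EuclideanSpace ℝ (Fin n))) : Set (EuclideanSpace ℝ (Fin n)) :=
  {v | v ∈ closure (Omega (dualCone C)) ∧ ∃ x ∈ frontier K, ∃ y ∈ frontier K, x ≠ y ∧
    inner ℝ x v = supportFun K v ∧ inner ℝ y v = supportFun K v}

/-- `x_K(v)`: for `v ∈ Ω_{C°} \ ω_K`, the unique boundary point of `K` with outer unit normal `v`. -/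
def reverseGaussMap (K : Set (EuclideanSpace ℝ (Fin n))) (v : EuclideanSpace ℝ (Fin n)) :
    EuclideanSpace ℝ (Fin n) :=
  Classical.epsilon fun x => x ∈ frontier K ∧ inner ℝ x v = supportFun K v

/-- The reverse radial Gauss map `α*_K(v) = r_K⁻¹(x_K(v))`, for `v ∈ Ω_{C°} \ ω_K`. -/
def reverseRadialGaussMap (C K : Set (EuclideanSpace ℝ (Fin n)))
    (v : EuclideanSpace ℝ (Fin n)) : EuclideanSpace ℝ (Fin n) :=
  Classical.epsilon fun u => u ∈ OmegaOf C K ∧ radialMap K u = reverseGaussMap K v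

/-- The Orlicz-integral Gauss curvature
`J_φ(K, η) = ∫_{α_K(η)} φ(ρ_K(α*_K(v))) dv` of `K ∈ ps(C)`, with values in `[0, ∞]`, where `dv` is
the spherical Lebesgue measure on `S^{n-1}`. The integral extends over the part of `α_K(η)` in the
domain `Ω_{C°} \ ω_K` of `α*_K`; the rest of `α_K(η)` is a null set. -/
def orliczCurvature (C : Set (EuclideanSpace ℝ (Fin n))) (φ : ℝ → ℝ)
    (K η : Set (EuclideanSpace ℝ (Fin n))) : ℝ≥0∞ :=
  ∫⁻ v : sphere (0 : EuclideanSpace ℝ (Fin n)) 1 in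
      Subtype.val ⁻¹' (radialGaussImage C K η ∩ (Omega (dualCone C) \ irregularNormals C K)),
    ENNReal.ofReal (φ (radialFun K (reverseRadialGaussMap C K v)))
    ∂((volume : Measure (EuclideanSpace ℝ (Fin n))).toSphere)

/-- The convex hull `⟨g⟩` associated with `(C, η, g)`: the intersection of all `L ∈ ps(C)` that
contain `g(u) u` for all `u ∈ η`. Only the values of `g` on `η` matter. -/
def coneHull (C η : Set (EuclideanSpace ℝ (Fin n))) (g : EuclideanSpace ℝ (Fin n) → ℝ) :
    Set (EuclideanSpace ℝ (Fin n)) :=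
  ⋂₀ {L | IsConePseudoCone C L ∧ ∀ u ∈ η, g u • u ∈ L}

/-- `K ∈ 𝒦*(C, η)`: `η` is a nonempty compact subset of `Ω_C`, and `K ∈ ps(C)` is `C`-defined by
`η`, that is, `K = ⟨ρ_K|_η⟩`. -/
structure IsDefinedBy (C η K : Set (EuclideanSpace ℝ (Fin n))) : Prop where
  nonempty : η.Nonempty
  isCompact : IsCompact η
  subset : η ⊆ Omega C
  isConePseudoCone : IsConePseudoCone C K
  eq_coneHull : K = coneHull C η (radialFun K)

end PseudoCones

end

open PseudoCones

/-! Both integrals run over the directions `v` that strictly expose some `r_K(u)` with `u ∈ η`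
(`mem_radialGaussImage_inter_iff`), taken in `Ω` of the respective dual cone. Cutting `K` down to `K
∩ C₁` preserves exposure and enlarges the dual cone. Conversely, `r_K(u)` is interior to `C₁`, and
exposure of a convex set near a point is global (`strictly_exposed_of_inter`). Since `r_K(u) + C₂ ⊆
K`, this forces `v ∈ C₂°`. So the domains differ only inside the boundary of `C₂°`, a spherical null
set (`toSphere_frontier_dualCone`). The integrands agree because the support points of both sets
coincide, lie in `int C₁`, and have the radial value as norm.

Fullness holds because `K` contains a translate of `C₂` and the directions of `C₁` stay uniformly
inside `C₂`. -/

open Filter Topology in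
/-- A segment starting at an interior point stays in the set for a while. -/
theorem PseudoCones.exists_segment_mem {n : ℕ} {C : Set (EuclideanSpace ℝ (Fin n))}
    {x : EuclideanSpace ℝ (Fin n)} (hx : x ∈ interior C) (y : EuclideanSpace ℝ (Fin n)) :
    ∃ t : ℝ, 0 < t ∧ t < 1 ∧ x + t • (y - x) ∈ C := by
  have hcont : Continuous fun t : ℝ => x + t • (y - x) := by fun_prop
  have h0 : ∀ᶠ t in 𝓝 (0 : ℝ), x + t • (y - x) ∈ C :=
    hcont.continuousAt.eventually (by simpa using mem_interior_iff_mem_nhds.1 hx)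
  have h1 : ∀ᶠ t in 𝓝[>] (0 : ℝ), t ∈ Ioo (0 : ℝ) 1 := Ioo_mem_nhdsGT one_pos
  obtain ⟨t, ht, ht'⟩ := ((h0.filter_mono nhdsWithin_le_nhds).and h1).exists
  exact ⟨t, ht'.1, ht'.2, ht⟩

open scoped Pointwise

namespace PseudoCones

variable {n : ℕ} {C D K η : Set (EuclideanSpace ℝ (Fin n))} {u v x y : EuclideanSpace ℝ (Fin n)}

/-! ### Cones and their duals -/

theorem isClosed_dualCone (C : Set (EuclideanSpace ℝ (Fin n))) : IsClosed (dualCone C) := by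
  simp only [dualCone, ofPred_forall]
  exact isClosed_biInter fun y _ => isClosed_le (by fun_prop) continuous_const

theorem smul_mem_dualCone (hv : v ∈ dualCone C) {c : ℝ} (hc : 0 ≤ c) : c • v ∈ dualCone C := by
  intro y hy
  rw [real_inner_smul_left]
  exact mul_nonpos_of_nonneg_of_nonpos hc (hv y hy)

theorem convex_dualCone (C : Set (EuclideanSpace ℝ (Fin n))) : Convex ℝ (dualCone C) := by
  intro v hv w hw a b ha hb _ y hy
  rw [inner_add_left]
  exact add_nonpos (smul_mem_dualCone hv ha y hy) (smul_mem_dualCone hw hb y hy)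

theorem dualCone_anti (h : C ⊆ D) : dualCone D ⊆ dualCone C := fun _ hv y hy => hv y (h hy)

theorem smul_mem_interior (hC : ∀ c : ℝ, 0 ≤ c → ∀ x ∈ C, c • x ∈ C) {c : ℝ} (hc : 0 < c)
    (hx : x ∈ interior C) : c • x ∈ interior C := by
  have h : c • C ⊆ C := by
    rintro _ ⟨y, hy, rfl⟩
    exact hC c hc.le y hy
  refine interior_mono h ?_
  rw [interior_smul₀ hc.ne']
  exact smul_mem_smul_set hx

theorem smul_mem_frontier_dualCone (hv : v ∈ frontier (dualCone C)) {c : ℝ} (hc : 0 < c) :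
    c • v ∈ frontier (dualCone C) := by
  rw [(isClosed_dualCone C).frontier_eq] at hv ⊢
  refine ⟨smul_mem_dualCone hv.1 hc.le, fun h => hv.2 ?_⟩
  have := smul_mem_interior (fun c hc x hx => smul_mem_dualCone hx hc) (inv_pos.2 hc) h
  rwa [smul_smul, inv_mul_cancel₀ hc.ne', one_smul] at this

/-- A functional in the interior of the dual cone is coercive on the cone. -/
theorem exists_inner_le_neg_mul_norm (hv : v ∈ interior (dualCone C)) :
    ∃ ε : ℝ, 0 < ε ∧ ∀ y ∈ C, inner ℝ y v ≤ -ε * ‖y‖ := by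
  obtain ⟨ε, hε, hball⟩ := Metric.nhds_basis_closedBall.mem_iff.1 (mem_interior_iff_mem_nhds.1 hv)
  refine ⟨ε, hε, fun y hy => ?_⟩
  rcases eq_or_ne y 0 with rfl | hy0
  · simp
  have hn : 0 < ‖y‖ := norm_pos_iff.2 hy0
  have hmem : v + (ε / ‖y‖) • y ∈ closedBall v ε := by
    simp [mem_closedBall, dist_eq_norm, norm_smul, abs_of_pos hε, hn.ne']
  have := hball hmem y hy
  rw [inner_add_left, real_inner_smul_left, real_inner_self_eq_norm_sq, real_inner_comm] at this
  have h2 : ε / ‖y‖ * ‖y‖ ^ 2 = ε * ‖y‖ := by field_simp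
  linarith

theorem inner_neg_of_mem_interior_dualCone (hv : v ∈ interior (dualCone C)) (hy : y ∈ C)
    (hy0 : y ≠ 0) : inner ℝ y v < 0 := by
  obtain ⟨ε, hε, h⟩ := exists_inner_le_neg_mul_norm hv
  have := mul_pos hε (norm_pos_iff.2 hy0)
  linarith [h y hy]

/-! ### Support points -/

theorem bddAbove_inner (hKC : K ⊆ C) (hv : v ∈ dualCone C) :
    BddAbove ((fun x => inner ℝ v x) '' K) :=
  ⟨0, by rintro _ ⟨y, hy, rfl⟩; exact hv y (hKC hy)⟩

theorem inner_le_supportFun (hKC : K ⊆ C) (hv : v ∈ dualCone C) (hy : y ∈ K) :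
    inner ℝ y v ≤ supportFun K v := by
  rw [real_inner_comm]
  exact le_csSup (bddAbove_inner hKC hv) ⟨y, hy, rfl⟩

theorem inner_eq_supportFun_iff (hKC : K ⊆ C) (hv : v ∈ dualCone C) (hx : x ∈ K) :
    inner ℝ x v = supportFun K v ↔ ∀ y ∈ K, inner ℝ y v ≤ inner ℝ x v := by
  refine ⟨fun h y hy => h ▸ inner_le_supportFun hKC hv hy, fun h => ?_⟩
  refine le_antisymm (inner_le_supportFun hKC hv hx) (csSup_le ⟨_, x, hx, rfl⟩ ?_)
  rintro _ ⟨y, hy, rfl⟩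
  simpa only [real_inner_comm] using h y hy

theorem mem_frontier_of_forall_inner_le (hv : v ≠ 0) (hx : x ∈ K)
    (h : ∀ y ∈ K, inner ℝ y v ≤ inner ℝ x v) : x ∈ frontier K := by
  refine ⟨subset_closure hx, fun hi => ?_⟩
  obtain ⟨t, ht, -, hmem⟩ := exists_segment_mem hi (x + v)
  have := h _ hmem
  rw [add_sub_cancel_left, inner_add_left, real_inner_smul_left] at this
  have := mul_pos ht (real_inner_self_pos.2 hv)
  linarith

/-- Trades the predicate behind `reverseGaussMap` for plain maximality, a form in which `K` and `K ∩
D` can be compared. -/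
theorem mem_frontier_and_inner_eq_iff (hcl : IsClosed K) (hKC : K ⊆ C) (hv : v ∈ dualCone C)
    (hv0 : v ≠ 0) :
    (x ∈ frontier K ∧ inner ℝ x v = supportFun K v) ↔
      x ∈ K ∧ ∀ y ∈ K, inner ℝ y v ≤ inner ℝ x v := by
  constructor
  · rintro ⟨hx, h⟩
    have hxK := hcl.frontier_subset hx
    exact ⟨hxK, (inner_eq_supportFun_iff hKC hv hxK).1 h⟩
  · rintro ⟨hx, h⟩
    exact ⟨mem_frontier_of_forall_inner_le hv0 hx h, (inner_eq_supportFun_iff hKC hv hx).2 h⟩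

/-- A closed subset of a cone has support points in all directions interior to the dual cone. -/
theorem exists_forall_inner_le (hcl : IsClosed K) (hne : K.Nonempty) (hKC : K ⊆ C)
    (hv : v ∈ interior (dualCone C)) : ∃ x ∈ K, ∀ y ∈ K, inner ℝ y v ≤ inner ℝ x v := by
  obtain ⟨x₀, hx₀⟩ := hne
  obtain ⟨ε, hε, h⟩ := exists_inner_le_neg_mul_norm hv
  have hcont : ContinuousOn (fun y => inner ℝ y v) K := by fun_prop
  refine hcont.exists_isMaxOn' hcl hx₀ ?_
  rw [Filter.eventually_inf_principal]
  have hlarge := (tendsto_norm_cocompact_atTop (E := EuclideanSpace ℝ (Fin n))).eventually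
    (Filter.eventually_ge_atTop (-inner ℝ x₀ v / ε))
  filter_upwards [hlarge] with y hy hyK
  rw [div_le_iff₀ hε] at hy
  linarith [h y (hKC hyK)]

/-! ### Pseudo-cones -/

theorem IsConePseudoCone.subset (hK : IsConePseudoCone C K) : K ⊆ C := by
  intro x hx
  rw [← hK.recessionCone_eq]
  intro y hy
  -- `(1 - t) y + x` is the convex combination of `y` and `t⁻¹ x`, both in `K`; let `t → 0`.
  have hlim : Filter.Tendsto (fun t : ℝ => (1 - t) • y + x) (nhdsWithin 0 (Ioi 0))
      (nhds (y + x)) := by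
    have : Continuous fun t : ℝ => (1 - t) • y + x := by fun_prop
    simpa using (this.tendsto 0).mono_left nhdsWithin_le_nhds
  refine hK.isClosed.mem_of_tendsto hlim ?_
  filter_upwards [Ioo_mem_nhdsGT (one_pos : (0 : ℝ) < 1)] with t ht
  have hmem := hK.smul_mem t⁻¹ ((one_lt_inv₀ ht.1).2 ht.2) x hx
  have := hK.convex hy hmem (sub_nonneg.2 ht.2.le) ht.1.le (by ring)
  rwa [smul_smul, mul_inv_cancel₀ ht.1.ne', one_smul] at this

theorem IsConePseudoCone.add_mem (hK : IsConePseudoCone C K) (hx : x ∈ K) (hy : y ∈ C) :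
    x + y ∈ K := by
  rw [← hK.recessionCone_eq] at hy
  exact hy x hx

theorem IsPseudoCone.ne_zero (hK : IsPseudoCone K) (hx : x ∈ K) : x ≠ 0 := by
  rintro rfl
  exact hK.zero_notMem hx

theorem IsPseudoCone.radialFun_pos_and_radialMap_mem (hK : IsPseudoCone K)
    (hu : ∃ r : ℝ, 0 < r ∧ r • u ∈ K) : 0 < radialFun K u ∧ radialMap K u ∈ K := by
  -- As `0 ∉ K`, the condition `0 < r` may be relaxed to `0 ≤ r`, so the set is closed and its
  -- infimum is attained.
  have hset : {r : ℝ | 0 < r ∧ r • u ∈ K} = Ici 0 ∩ (fun r : ℝ => r • u) ⁻¹' K := by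
    ext r
    refine ⟨fun h => ⟨h.1.le, h.2⟩, fun h => ⟨lt_of_le_of_ne h.1 ?_, h.2⟩⟩
    rintro rfl
    exact hK.zero_notMem (by simpa using h.2)
  have hcl : IsClosed {r : ℝ | 0 < r ∧ r • u ∈ K} := by
    rw [hset]
    exact isClosed_Ici.inter (hK.isClosed.preimage (by fun_prop))
  exact hcl.csInf_mem hu ⟨0, fun r hr => hr.1.le⟩

/-- On a direction set compactly contained in the cone, the radial function is bounded. -/
theorem IsConePseudoCone.exists_forall_smul_mem (hK : IsConePseudoCone C K)
    (hC : ∀ c : ℝ, 0 ≤ c → ∀ x ∈ C, c • x ∈ C) (hη : IsCompact η) (hsub : η ⊆ interior C) :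
    ∃ R : ℝ, 0 < R ∧ ∀ u ∈ η, ∀ r : ℝ, R ≤ r → r • u ∈ K := by
  obtain ⟨x₀, hx₀⟩ := hK.nonempty
  obtain ⟨δ, hδ, hthick⟩ := hη.exists_cthickening_subset_open isOpen_interior hsub
  have hn : 0 < ‖x₀‖ := norm_pos_iff.2 (hK.ne_zero hx₀)
  refine ⟨‖x₀‖ / δ, by positivity, fun u hu r hr => ?_⟩
  have hr0 : 0 < r := lt_of_lt_of_le (by positivity) hr
  -- `r u = x₀ + r (u - r⁻¹ x₀)`, and for `r ≥ ‖x₀‖ / δ` the bracket is within `δ` of `u`.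
  have hmem : u - r⁻¹ • x₀ ∈ C := by
    refine interior_subset (hthick (mem_cthickening_of_dist_le _ u _ _ hu ?_))
    rw [dist_eq_norm, sub_sub_cancel_left, norm_neg, norm_smul, norm_inv, Real.norm_of_nonneg hr0.le,
      inv_mul_le_iff₀ hr0]
    rwa [div_le_iff₀ hδ] at hr
  have := hK.add_mem hx₀ (hC r hr0.le _ hmem)
  rwa [smul_sub, smul_smul, mul_inv_cancel₀ hr0.ne', one_smul, add_sub_cancel] at this

theorem IsConePseudoCone.exists_smul_mem (hK : IsConePseudoCone C K)
    (hC : ∀ c : ℝ, 0 ≤ c → ∀ x ∈ C, c • x ∈ C) (hu : u ∈ interior C) :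
    ∃ r : ℝ, 0 < r ∧ r • u ∈ K := by
  obtain ⟨R, hR, h⟩ := hK.exists_forall_smul_mem hC (isCompact_singleton (x := u)) (by simpa)
  exact ⟨R, hR, h u rfl R le_rfl⟩

theorem radialFun_inter (hC : ∀ c : ℝ, 0 ≤ c → ∀ x ∈ C, c • x ∈ C) (hu : u ∈ C) :
    radialFun (K ∩ C) u = radialFun K u := by
  unfold radialFun
  congr 1
  ext r
  exact ⟨fun h => ⟨h.1, h.2.1⟩, fun h => ⟨h.1, h.2, hC r h.1.le u hu⟩⟩

theorem radialMap_inter (hC : ∀ c : ℝ, 0 ≤ c → ∀ x ∈ C, c • x ∈ C) (hu : u ∈ C) :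
    radialMap (K ∩ C) u = radialMap K u := by
  rw [radialMap, radialMap, radialFun_inter hC hu]

theorem ne_zero_of_mem_Omega (hv : v ∈ Omega C) : v ≠ 0 :=
  ne_zero_of_mem_unit_sphere ⟨v, hv.1⟩

/-- The domain of integration of `orliczCurvature` consists of the `v ∈ Ω_{C°}` that strictly expose
some point `r_K(u)` with `u ∈ η`. -/
theorem mem_radialGaussImage_inter_iff (hK : IsConePseudoCone C K)
    (hC : ∀ c : ℝ, 0 ≤ c → ∀ x ∈ C, c • x ∈ C) (hη : η ⊆ Omega C) :
    v ∈ radialGaussImage C K η ∩ (Omega (dualCone C) \ irregularNormals C K) ↔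
      v ∈ Omega (dualCone C) ∧ ∃ u ∈ η, ∀ y ∈ K, y ≠ radialMap K u →
        inner ℝ y v < inner ℝ (radialMap K u) v := by
  have hmem : ∀ u ∈ η, radialMap K u ∈ K := fun u hu =>
    (hK.radialFun_pos_and_radialMap_mem (hK.exists_smul_mem hC (hη hu).2)).2
  constructor
  · rintro ⟨⟨-, _, ⟨u, hu, rfl⟩, hx⟩, hvΩ, hirr⟩
    have hvD : v ∈ dualCone C := interior_subset hvΩ.2
    refine ⟨hvΩ, u, hu, fun y hy hne => ?_⟩
    have hle := (inner_eq_supportFun_iff hK.subset hvD (hmem u hu)).1 hx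
    refine lt_of_le_of_ne (hle y hy) fun heq => hirr ?_
    have hfr := fun {z} => mem_frontier_and_inner_eq_iff (x := z) hK.isClosed hK.subset hvD
      (ne_zero_of_mem_Omega hvΩ)
    obtain ⟨h1, h1'⟩ := hfr.2 ⟨hmem u hu, hle⟩
    obtain ⟨h2, h2'⟩ := hfr.2 ⟨hy, by rwa [heq]⟩
    exact ⟨subset_closure hvΩ, y, h2, _, h1, hne, h2', h1'⟩
  · rintro ⟨hvΩ, u, hu, h⟩
    have hvD : v ∈ dualCone C := interior_subset hvΩ.2
    have hle : ∀ y ∈ K, inner ℝ y v ≤ inner ℝ (radialMap K u) v := fun y hy => by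
      rcases eq_or_ne y (radialMap K u) with rfl | hne
      · rfl
      · exact (h y hy hne).le
    have hsup := (inner_eq_supportFun_iff hK.subset hvD (hmem u hu)).2 hle
    refine ⟨⟨subset_closure hvΩ, _, ⟨u, hu, rfl⟩, hsup⟩, hvΩ, ?_⟩
    have huniq : ∀ y ∈ frontier K, inner ℝ y v = supportFun K v → y = radialMap K u :=
      fun y hy hyv => by
        by_contra hne
        exact (h y (hK.isClosed.frontier_subset hy) hne).ne (hyv.trans hsup.symm)
    rintro ⟨-, y, hy, z, hz, hne, hyv, hzv⟩
    exact hne ((huniq y hy hyv).trans (huniq z hz hzv).symm)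

/-- A direction interior to the dual cone whose support point `x_K(v)` is interior to `C` has
`ρ_K(α*_K(v)) = |x_K(v)|`. -/
theorem radialFun_reverseRadialGaussMap (hK : IsConePseudoCone C K)
    (hC : ∀ c : ℝ, 0 ≤ c → ∀ x ∈ C, c • x ∈ C) (hv : v ∈ interior (dualCone C))
    (hxK : reverseGaussMap K v ∈ K) (hxC : reverseGaussMap K v ∈ interior C)
    (hmax : ∀ y ∈ K, inner ℝ y v ≤ inner ℝ (reverseGaussMap K v) v) :
    radialFun K (reverseRadialGaussMap C K v) = ‖reverseGaussMap K v‖ := by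
  set x := reverseGaussMap K v with hx
  have hn : 0 < ‖x‖ := norm_pos_iff.2 (hK.ne_zero hxK)
  have hu₀ : ‖x‖⁻¹ • x ∈ Omega C :=
    ⟨by simp [norm_smul, hn.ne'], smul_mem_interior hC (inv_pos.2 hn) hxC⟩
  have hray : ‖x‖ • ‖x‖⁻¹ • x = x := by rw [smul_smul, mul_inv_cancel₀ hn.ne', one_smul]
  have hex : ∃ u, u ∈ OmegaOf C K ∧ radialMap K u = x := by
    refine ⟨‖x‖⁻¹ • x, ⟨subset_closure hu₀, ‖x‖, hn, by rwa [hray]⟩, ?_⟩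
    have hrad : radialFun K (‖x‖⁻¹ • x) = ‖x‖ := by
      refine IsLeast.csInf_eq ⟨⟨hn, by rwa [hray]⟩, ?_⟩
      rintro r ⟨hr, hrK⟩
      have h1 := hmax _ hrK
      rw [smul_smul, real_inner_smul_left] at h1
      -- Since `⟨x, v⟩ < 0`, a point of `K` on the ray before `x` would beat the maximum at `x`.
      have h2 := inner_neg_of_mem_interior_dualCone hv (hK.subset hxK) (hK.ne_zero hxK)
      have h3 : 1 ≤ r * ‖x‖⁻¹ := by
        by_contra! h
        nlinarith
      rwa [← div_eq_mul_inv, one_le_div hn] at h3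
    rw [radialMap, hrad, hray]
  obtain ⟨⟨hcl, hr⟩, hmap⟩ : reverseRadialGaussMap C K v ∈ OmegaOf C K ∧
      radialMap K (reverseRadialGaussMap C K v) = x := Classical.epsilon_spec hex
  have hunit : ‖reverseRadialGaussMap C K v‖ = 1 := by
    have := closure_minimal (fun _ h => h.1) isClosed_sphere hcl
    simpa using this
  have hpos := (hK.radialFun_pos_and_radialMap_mem hr).1
  rw [← hmap, radialMap, norm_smul, hunit, mul_one, Real.norm_of_nonneg hpos.le]

/-! ### Directions uniformly exposing a point of `K` inside a smaller cone -/

/-- The directions `v` for which some point of `K ∩ int D` lies above all points of `K \ int D`,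
by an amount at least proportional to the distance. -/
def exposingDirections (D K : Set (EuclideanSpace ℝ (Fin n))) : Set (EuclideanSpace ℝ (Fin n)) :=
  {v | ∃ x ∈ K ∩ interior D, ∃ ε : ℝ, 0 < ε ∧ ∀ y ∈ K \ interior D,
    inner ℝ (y - x) v ≤ -ε * ‖y - x‖}

/-- By Cauchy–Schwarz, moving `v` by less than `ε / 2` costs at most half of the linear margin. -/
theorem isOpen_exposingDirections : IsOpen (exposingDirections D K) := by
  rw [Metric.isOpen_iff]
  rintro v ⟨x, hx, ε, hε, h⟩
  refine ⟨ε / 2, by positivity, fun w hw => ⟨x, hx, ε / 2, by positivity, fun y hy => ?_⟩⟩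
  have h1 := h y hy
  have h2 := real_inner_le_norm (y - x) (w - v)
  rw [mem_ball, dist_eq_norm] at hw
  have h3 := mul_le_mul_of_nonneg_left hw.le (norm_nonneg (y - x))
  rw [inner_sub_right] at h2
  linarith

/-- Compactness gives a margin `m` on a small sphere of radius `r` about `x`; along segments from
`x` it grows linearly, giving slope `m / r`. -/
theorem mem_exposingDirections_of_strictly_exposed (hcl : IsClosed K) (hconv : Convex ℝ K)
    (hxK : x ∈ K) (hxD : x ∈ interior D)
    (h : ∀ y ∈ K, y ≠ x → inner ℝ y v < inner ℝ x v) : v ∈ exposingDirections D K := by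
  obtain ⟨r, hr, hball⟩ := Metric.isOpen_iff.1 isOpen_interior x hxD
  have hcomp : IsCompact (sphere x r ∩ K) := (isCompact_sphere x r).inter_right hcl
  obtain ⟨m, hm, hm'⟩ := hcomp.exists_forall_le' (f := fun z => inner ℝ x v - inner ℝ z v)
    (a := 0) (by fun_prop) fun z hz => sub_pos.2 (h z hz.2 (ne_of_mem_sphere hz.1 hr.ne'))
  refine ⟨x, ⟨hxK, hxD⟩, m / r, by positivity, fun y hy => ?_⟩
  have hd : r ≤ ‖y - x‖ := by
    by_contra! hlt
    exact hy.2 (hball (by rwa [mem_ball, dist_eq_norm]))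
  have hd0 : 0 < ‖y - x‖ := hr.trans_le hd
  have hz : x + (r / ‖y - x‖) • (y - x) ∈ sphere x r ∩ K := by
    refine ⟨?_, hconv.add_smul_sub_mem hxK hy.1 ⟨by positivity, (div_le_one hd0).2 hd⟩⟩
    simp [norm_smul, abs_of_pos hr, hd0.ne']
  have := hm' _ hz
  rw [inner_add_left, real_inner_smul_left] at this
  have h4 : r / ‖y - x‖ * inner ℝ (y - x) v ≤ -m := by linarith
  rw [div_mul_eq_mul_div, div_le_iff₀ hd0] at h4
  rw [← neg_div, div_mul_eq_mul_div, le_div_iff₀ hr]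
  linarith

theorem forall_inner_le_inter_iff (hv : v ∈ exposingDirections D K) :
    (x ∈ K ∧ ∀ y ∈ K, inner ℝ y v ≤ inner ℝ x v) ↔
      x ∈ K ∩ D ∧ ∀ y ∈ K ∩ D, inner ℝ y v ≤ inner ℝ x v := by
  obtain ⟨z, hz, ε, hε, h⟩ := hv
  have hlt : ∀ y ∈ K \ interior D, inner ℝ y v < inner ℝ z v := fun y hy => by
    have hne : y - z ≠ 0 := fun h0 => hy.2 (sub_eq_zero.1 h0 ▸ hz.2)
    have h1 := h y hy
    have h2 := mul_pos hε (norm_pos_iff.2 hne)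
    rw [inner_sub_left] at h1
    linarith
  constructor
  · rintro ⟨hx, hmax⟩
    refine ⟨⟨hx, ?_⟩, fun y hy => hmax y hy.1⟩
    by_contra hxD
    exact (hlt x ⟨hx, fun hi => hxD (interior_subset hi)⟩).not_ge (hmax z hz.1)
  · rintro ⟨hx, hmax⟩
    refine ⟨hx.1, fun y hy => ?_⟩
    by_cases hyD : y ∈ interior D
    · exact hmax y ⟨hy, interior_subset hyD⟩
    · exact (hlt y ⟨hy, hyD⟩).le.trans (hmax z ⟨hz.1, interior_subset hz.2⟩)

theorem mem_interior_of_forall_inner_le (hv : v ∈ exposingDirections D K) (hx : x ∈ K)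
    (hmax : ∀ y ∈ K, inner ℝ y v ≤ inner ℝ x v) : x ∈ interior D := by
  obtain ⟨z, hz, ε, hε, h⟩ := hv
  by_contra hxD
  have hne : x - z ≠ 0 := fun h0 => hxD (sub_eq_zero.1 h0 ▸ hz.2)
  have h1 := h x ⟨hx, hxD⟩
  have h2 := mul_pos hε (norm_pos_iff.2 hne)
  rw [inner_sub_left] at h1
  linarith [hmax z hz.1]

/-- A short initial piece of the segment from `x` to `y` stays in `K ∩ D`, and a linear functional
decreasing there decreases along the whole segment. -/
theorem strictly_exposed_of_inter (hconv : Convex ℝ K) (hxK : x ∈ K) (hxD : x ∈ interior D)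
    (h : ∀ y ∈ K ∩ D, y ≠ x → inner ℝ y v < inner ℝ x v) :
    ∀ y ∈ K, y ≠ x → inner ℝ y v < inner ℝ x v := by
  intro y hy hne
  obtain ⟨t, ht0, ht1, ht⟩ := exists_segment_mem hxD y
  have := h _ ⟨hconv.add_smul_sub_mem hxK hy ⟨ht0.le, ht1.le⟩, ht⟩
    (by simp [ht0.ne', sub_ne_zero.2 hne])
  rw [inner_add_left, real_inner_smul_left, inner_sub_left] at this
  nlinarith

/-! ### The spherical measure of the boundary of a dual cone -/

/-- Up to a factor, spherical measure is the volume of the truncated cone over a set. Here that cone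
stays in the frontier of a convex set, which is Lebesgue null. -/
theorem toSphere_frontier_dualCone (C : Set (EuclideanSpace ℝ (Fin n))) :
    (volume : Measure (EuclideanSpace ℝ (Fin n))).toSphere
      (Subtype.val ⁻¹' frontier (dualCone C)) = 0 := by
  rw [Measure.toSphere_apply' _ (isClosed_frontier.measurableSet.preimage measurable_subtype_coe)]
  have hsub : Ioo (0 : ℝ) 1 • ((↑) '' ((↑) ⁻¹' frontier (dualCone C) :
      Set (sphere (0 : EuclideanSpace ℝ (Fin n)) 1))) ⊆ frontier (dualCone C) := by
    rintro _ ⟨c, hc, _, ⟨w, hw, rfl⟩, rfl⟩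
    exact smul_mem_frontier_dualCone hw hc.1
  rw [measure_mono_null hsub ((convex_dualCone C).addHaar_frontier volume), mul_zero]

/-! ### Restriction of a pseudo-cone to a smaller cone -/

theorem IsConePseudoCone.inter (hK : IsConePseudoCone C K) (hD : IsSolidPointedCone D)
    (hDC : D ⊆ C) (hne : (K ∩ D).Nonempty) : IsConePseudoCone D (K ∩ D) where
  nonempty := hne
  isClosed := hK.isClosed.inter hD.isClosed
  convex := hK.convex.inter hD.convex
  zero_notMem h := hK.zero_notMem h.1
  smul_mem c hc x hx := ⟨hK.smul_mem c hc x hx.1, hD.smul_mem c (by linarith) x hx.2⟩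
  solid := hD.solid
  pointed := hD.pointed
  recessionCone_eq := by
    have hadd : ∀ x ∈ D, ∀ z ∈ D, x + z ∈ D := fun x hx z hz => by
      have := hD.smul_mem 2 (by norm_num) _
        (hD.convex hx hz (by norm_num : (0 : ℝ) ≤ 1 / 2) (by norm_num : (0 : ℝ) ≤ 1 / 2)
          (by norm_num))
      rwa [smul_add, smul_smul, smul_smul, show (2 : ℝ) * (1 / 2) = 1 by norm_num, one_smul,
        one_smul] at this
    refine Subset.antisymm (fun z hz => ?_) fun z hz x hx =>
      ⟨hK.add_mem hx.1 (hDC hz), hadd x hx.2 z hz⟩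
    obtain ⟨x, hx⟩ := hne
    have hiter : ∀ m : ℕ, x + m • z ∈ K ∩ D := fun m => by
      induction m with
      | zero => simpa using hx
      | succ m ih =>
        have := hz _ ih
        rwa [add_assoc, ← succ_nsmul] at this
    -- `z` is the limit of `(x + (m + 1) z) / (m + 1)`, which lies in the closed cone `D`.
    have hlim : Filter.Tendsto (fun m : ℕ => ((m : ℝ) + 1)⁻¹ • x + z) Filter.atTop
        (nhds ((0 : ℝ) • x + z)) := by
      have := tendsto_one_div_add_atTop_nhds_zero_nat (𝕜 := ℝ)
      simp only [one_div] at this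
      exact (this.smul_const x).add_const z
    rw [zero_smul, zero_add] at hlim
    refine hD.isClosed.mem_of_tendsto hlim (Filter.Eventually.of_forall fun m => ?_)
    have hm : (0 : ℝ) < m + 1 := by positivity
    have := hD.smul_mem ((m : ℝ) + 1)⁻¹ (by positivity) _ (hiter (m + 1)).2
    rw [← Nat.cast_smul_eq_nsmul ℝ, smul_add, smul_smul, Nat.cast_add_one,
      inv_mul_cancel₀ hm.ne', one_smul] at this
    exact this

theorem IsConePseudoCone.isFull_inter (hK : IsConePseudoCone C K) (hC : IsSolidPointedCone C)
    (hD : IsSolidPointedCone D) (hcomp : IsCompact (sphere 0 1 ∩ D))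
    (hsub : sphere 0 1 ∩ D ⊆ Omega C) : IsFull D (K ∩ D) where
  isClosed := hK.isClosed.inter hD.isClosed
  convex := hK.convex.inter hD.convex
  subset := inter_subset_right
  isBounded_diff := by
    obtain ⟨R, hR, h⟩ := hK.exists_forall_smul_mem hC.smul_mem hcomp fun u hu => (hsub hu).2
    refine (isBounded_closedBall (x := 0) (r := R)).subset fun x hx => ?_
    rw [mem_closedBall_zero_iff]
    by_contra! hlt
    have hn : 0 < ‖x‖ := hR.trans hlt
    have := h (‖x‖⁻¹ • x) ⟨by simp [norm_smul, hn.ne'],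
      hD.smul_mem _ (inv_nonneg.2 hn.le) x hx.1⟩ ‖x‖ hlt.le
    rw [smul_smul, mul_inv_cancel₀ hn.ne', one_smul] at this
    exact hx.2 ⟨this, hx.1⟩

/-- The radial functions of `K` and `K ∩ D` at the reverse radial Gauss images agree in the
directions exposing points of `K ∩ int D`. -/
theorem radialFun_reverseRadialGaussMap_inter (hK : IsConePseudoCone C K)
    (hC : IsSolidPointedCone C) (hD : IsSolidPointedCone D) (hDC : D ⊆ C)
    (hK' : IsConePseudoCone D (K ∩ D)) (hvC : v ∈ interior (dualCone C)) (hv0 : v ≠ 0)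
    (hv : v ∈ exposingDirections D K) :
    radialFun K (reverseRadialGaussMap C K v) =
      radialFun (K ∩ D) (reverseRadialGaussMap D (K ∩ D) v) := by
  have hvD : v ∈ interior (dualCone D) := interior_mono (dualCone_anti hDC) hvC
  have hiff := fun x => mem_frontier_and_inner_eq_iff (x := x) hK.isClosed hK.subset
    (interior_subset hvC) hv0
  have hiff' := fun x => mem_frontier_and_inner_eq_iff (x := x) hK'.isClosed hK'.subset
    (interior_subset hvD) hv0
  -- Both choices are `epsilon` of the same predicate, so they agree without appeal to uniqueness.
  have heq : reverseGaussMap (K ∩ D) v = reverseGaussMap K v := by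
    unfold reverseGaussMap
    congr 1
    funext x
    exact propext ((hiff' x).trans ((forall_inner_le_inter_iff hv).symm.trans (hiff x).symm))
  obtain ⟨hxK, hmax⟩ : reverseGaussMap K v ∈ K ∧
      ∀ y ∈ K, inner ℝ y v ≤ inner ℝ (reverseGaussMap K v) v := by
    obtain ⟨x, hx⟩ := exists_forall_inner_le hK.isClosed hK.nonempty hK.subset hvC
    exact (hiff _).1 (Classical.epsilon_spec
      (p := fun x => x ∈ frontier K ∧ inner ℝ x v = supportFun K v) ⟨x, (hiff x).2 hx⟩)
  have hxD := mem_interior_of_forall_inner_le hv hxK hmax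
  obtain ⟨hxK', hmax'⟩ := (forall_inner_le_inter_iff hv).1 ⟨hxK, hmax⟩
  rw [radialFun_reverseRadialGaussMap hK hC.smul_mem hvC hxK (interior_mono hDC hxD) hmax,
    radialFun_reverseRadialGaussMap hK' hD.smul_mem hvD (heq ▸ hxK') (heq ▸ hxD) (heq ▸ hmax'), heq]

theorem orliczCurvature_inter (hK : IsConePseudoCone C K) (hC : IsSolidPointedCone C)
    (hD : IsSolidPointedCone D) (hDC : D ⊆ C) (hK' : IsConePseudoCone D (K ∩ D)) (φ : ℝ → ℝ)
    (hη : η ⊆ Omega D) : orliczCurvature C φ K η = orliczCurvature D φ (K ∩ D) η := by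
  have hηC : η ⊆ Omega C := fun u hu => ⟨(hη hu).1, interior_mono hDC (hη hu).2⟩
  have hrad : ∀ u ∈ η, radialMap (K ∩ D) u = radialMap K u := fun u hu =>
    radialMap_inter hD.smul_mem (interior_subset (hη hu).2)
  have hpt : ∀ u ∈ η, radialMap K u ∈ K ∧ radialMap K u ∈ interior D := fun u hu => by
    obtain ⟨hpos, hmem⟩ :=
      hK.radialFun_pos_and_radialMap_mem (hK.exists_smul_mem hC.smul_mem (hηC hu).2)
    exact ⟨hmem, smul_mem_interior hD.smul_mem hpos (hη hu).2⟩
  have hiff := fun v => mem_radialGaussImage_inter_iff (v := v) hK hC.smul_mem hηC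
  have hiff' := fun v => mem_radialGaussImage_inter_iff (v := v) hK' hD.smul_mem hη
  unfold orliczCurvature
  set S := radialGaussImage C K η ∩ (Omega (dualCone C) \ irregularNormals C K)
  set T := radialGaussImage D (K ∩ D) η ∩ (Omega (dualCone D) \ irregularNormals D (K ∩ D))
  have hST : S ⊆ T := fun v hv => by
    obtain ⟨hvΩ, u, hu, h⟩ := (hiff v).1 hv
    refine (hiff' v).2 ⟨⟨hvΩ.1, interior_mono (dualCone_anti hDC) hvΩ.2⟩, u, hu, ?_⟩
    rw [hrad u hu]
    exact fun y hy => h y hy.1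
  have hTS : T ⊆ S ∪ frontier (dualCone C) := fun v hv => by
    obtain ⟨hvΩ, u, hu, h⟩ := (hiff' v).1 hv
    rw [hrad u hu] at h
    obtain ⟨hxK, hxD⟩ := hpt u hu
    have hexp := strictly_exposed_of_inter hK.convex hxK hxD h
    -- Translating the exposed point by `y ∈ C` stays in `K`, so `v` cannot increase along `y`.
    have hvC : v ∈ dualCone C := fun y hy => by
      rcases eq_or_ne y 0 with rfl | hy0
      · simp
      have := hexp _ (hK.add_mem hxK hy) (by simpa using hy0)
      rw [inner_add_left] at this
      rw [real_inner_comm]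
      linarith
    by_cases hvi : v ∈ interior (dualCone C)
    · exact Or.inl ((hiff v).2 ⟨⟨hvΩ.1, hvi⟩, u, hu, hexp⟩)
    · exact Or.inr ((isClosed_dualCone C).frontier_eq ▸ ⟨hvC, hvi⟩)
  have hae : (Subtype.val ⁻¹' S : Set (sphere (0 : EuclideanSpace ℝ (Fin n)) 1))
      =ᵐ[(volume : Measure (EuclideanSpace ℝ (Fin n))).toSphere] Subtype.val ⁻¹' T := by
    refine Filter.EventuallyLE.antisymm (LE.le.eventuallyLE (preimage_mono hST)) ?_
    refine ae_le_set.2 (measure_mono_null ?_ (toSphere_frontier_dualCone C))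
    rintro v ⟨hvT, hvS⟩
    exact (hTS hvT).resolve_left hvS
  rw [← Measure.restrict_congr_set hae]
  -- `S` need not be measurable a priori, so the integrands are compared on an open superset.
  have hSU : S ⊆ interior (dualCone C) ∩ exposingDirections D K := fun v hv => by
    obtain ⟨hvΩ, u, hu, h⟩ := (hiff v).1 hv
    exact ⟨hvΩ.2, mem_exposingDirections_of_strictly_exposed hK.isClosed hK.convex (hpt u hu).1
      (hpt u hu).2 h⟩
  have hU : MeasurableSet (Subtype.val ⁻¹' (interior (dualCone C) ∩ exposingDirections D K) :
      Set (sphere (0 : EuclideanSpace ℝ (Fin n)) 1)) :=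
    (isOpen_interior.inter isOpen_exposingDirections).measurableSet.preimage measurable_subtype_coe
  refine lintegral_congr_ae ?_
  filter_upwards [ae_restrict_of_ae_restrict_of_subset (preimage_mono hSU) (ae_restrict_mem hU)]
    with v hv
  rw [radialFun_reverseRadialGaussMap_inter hK hC hD hDC hK' hv.1
    (ne_zero_of_mem_unit_sphere v) hv.2]

end PseudoCones

open PseudoCones
theorem lemma6p1 (n : ℕ) (C₁ C₂ K : Set (EuclideanSpace ℝ (Fin n)))
    (hC₁ : IsSolidPointedCone C₁) (hC₂ : IsSolidPointedCone C₂) (hC : C₁ ⊆ C₂)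
    (hK : IsDefinedBy C₂ (sphere 0 1 ∩ C₁) K) :
    IsConePseudoCone C₁ (K ∩ C₁) ∧
    IsFull C₁ (K ∩ C₁) ∧
    ∀ φ : ℝ → ℝ, ContinuousOn φ (Ioi 0) → (∀ t, 0 < t → 0 < φ t) →
      ∀ η : Set (EuclideanSpace ℝ (Fin n)), MeasurableSet η → η ⊆ Omega C₁ →
        orliczCurvature C₂ φ K η = orliczCurvature C₁ φ (K ∩ C₁) η := by
  have hK₂ := hK.isConePseudoCone
  obtain ⟨u, hu⟩ := hK.nonempty
  obtain ⟨r, hr, hrK⟩ := hK₂.exists_smul_mem hC₂.smul_mem (hK.subset hu).2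
  have hK₁ := hK₂.inter hC₁ hC ⟨r • u, hrK, hC₁.smul_mem r hr.le u hu.2⟩
  exact ⟨hK₁, hK₂.isFull_inter hC₂ hC₁ hK.isCompact hK.subset,
    fun φ _ _ η _ hη => orliczCurvature_inter hK₂ hC₂ hC₁ hC hK₁ φ hη⟩
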